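/- A $2$-colored graph $H=(V,E_r,E_b)$ consists of a vertex set $V$ and two sets $E_r,E_b\subseteq\binom V2$ of red and blue edges (a pair may have both colors). A homomorphism between $2$-colored graphs is a map of the vertex sets that sends red edges to red edges and blue edges to blue edges; $H$ is $G$-colorable if there is a homomorphism from $H$ to $G$, and $G$ contains $H$ if there is an injective one. The Turán density of $H$ is $$\pi(H)=\lim_{n\to\infty}\max_{G}\frac{|E_r(G)|+|E_b(G)|}{\binom n2},$$ where $G$ runs over the $2$-colored graphs on $n$ vertices that do not contain $H$. Writing $ab$ for $\{a,b\}$, let $H_8$ be the $2$-colored graph on $\{1,\dots,8\}$ with $$E_r=\{12,13,24,34,16,37,48,25,35,18,46,27\},\qquad E_b=\{56,57,68,78,26,15,47,38,35,18,46,27\},$$ and let $T,T_1,T_2$ be the $2$-colored graphs on $\{1,2,3,4\}$ with - $T$: $E_r=\{12,13,34\}$, $E_b=\{12,23,34\}$; - $T_1$: $E_r=\{12,34,13,24\}$, $E_b=\{12,34,14,23\}$; - $T_2$: $E_r=\{12,14,23,24,34\}$, $E_b=\{12,13,14,23,34\}$. **Lemma.** The limit defining $\pi(H_8)$ exists and $\pi(H_8)=\frac43$.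 Moreover, $H_8$ is $T_1$-colorable and $T_2$-colorable, and $H_8$ is not $T$-colorable. -/

import Mathlib

open Filter Topology

/-- A 2-colored graph `(V, E_r, E_b)`: a set of red edges and a set of blue edges on the vertex
set `V`, without loops; a pair may carry no color, one color, or both colors. -/
structure TwoColoredGraph (V : Type*) where
  /-- the graph of red edges -/
  red : SimpleGraph V
  /-- the graph of blue edges -/
  blue : SimpleGraph V

namespace TwoColoredGraph

/-- The 2-colored graph with vertex set `[n] = {1, …, n}` and the listed red and blue edges; the
pair `(a, b)` in a list stands for the edge `ab`, and `i : Fin n` stands for the vertex `i + 1`. -/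
def ofEdges (n : ℕ) (redEdges blueEdges : List (ℕ × ℕ)) : TwoColoredGraph (Fin n) where
  red := SimpleGraph.fromRel fun i j => ((i : ℕ) + 1, (j : ℕ) + 1) ∈ redEdges
  blue := SimpleGraph.fromRel fun i j => ((i : ℕ) + 1, (j : ℕ) + 1) ∈ blueEdges

/-- `f` is a graph homomorphism from `H` to `G`: it maps red edges to red edges and blue edges
to blue edges. -/
def IsHom {W V : Type*} (H : TwoColoredGraph W) (G : TwoColoredGraph V) (f : W → V) : Prop :=
  (∀ u v, H.red.Adj u v → G.red.Adj (f u) (f v)) ∧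
    ∀ u v, H.blue.Adj u v → G.blue.Adj (f u) (f v)

/-- `H` is `G`-colorable: there is a graph homomorphism from `H` to `G`. -/
def ColorableBy {W V : Type*} (H : TwoColoredGraph W) (G : TwoColoredGraph V) : Prop :=
  ∃ f : W → V, H.IsHom G f

/-- `G` contains (a copy of) `H` as a subgraph. -/
def Contains {V W : Type*} (G : TwoColoredGraph V) (H : TwoColoredGraph W) : Prop :=
  ∃ f : W → V, Function.Injective f ∧ H.IsHom G f

/-- The edge density `h_n(G) = (|E_r(G)| + |E_b(G)|) / (n choose 2)` of a 2-colored graph on `n`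
vertices; an edge with both colors counts twice. -/
noncomputable def edgeDensity {n : ℕ} (G : TwoColoredGraph (Fin n)) : ℝ :=
  ((G.red.edgeSet.ncard : ℝ) + (G.blue.edgeSet.ncard : ℝ)) / (n.choose 2 : ℝ)

/-- `π_n(H)`: the maximum of `h_n(G)` over all `H`-free 2-colored graphs `G` on `n` vertices
(there are finitely many of them). -/
noncomputable def maxDensity {W : Type*} (H : TwoColoredGraph W) (n : ℕ) : ℝ :=
  sSup {d : ℝ | ∃ G : TwoColoredGraph (Fin n), ¬ G.Contains H ∧ d = G.edgeDensity}

/-- The Turán density `π(H) = lim π_n(H)` exists and equals `d`. -/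
def HasTuranDensity {W : Type*} (H : TwoColoredGraph W) (d : ℝ) : Prop :=
  Tendsto (fun n : ℕ => H.maxDensity n) atTop (𝓝 d)

/-- The 2-colored graph `T`. -/
def T : TwoColoredGraph (Fin 4) :=
  ofEdges 4 [(1, 2), (1, 3), (3, 4)] [(1, 2), (2, 3), (3, 4)]

/-- The 2-colored graph `T_1`. -/
def T1 : TwoColoredGraph (Fin 4) :=
  ofEdges 4 [(1, 2), (3, 4), (1, 3), (2, 4)] [(1, 2), (3, 4), (1, 4), (2, 3)]

/-- The 2-colored graph `T_2`. -/
def T2 : TwoColoredGraph (Fin 4) :=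
  ofEdges 4 [(1, 2), (1, 4), (2, 3), (2, 4), (3, 4)] [(1, 2), (1, 3), (1, 4), (2, 3), (3, 4)]

/-- The 2-colored graph `H_8`. -/
def H8 : TwoColoredGraph (Fin 8) :=
  ofEdges 8
    [(1, 2), (1, 3), (2, 4), (3, 4), (1, 6), (3, 7), (4, 8), (2, 5), (3, 5), (1, 8), (4, 6), (2, 7)]
    [(5, 6), (5, 7), (6, 8), (7, 8), (2, 6), (1, 5), (4, 7), (3, 8), (3, 5), (1, 8), (4, 6), (2, 7)]

end TwoColoredGraph

/-! Lower bound: the underlying graph of `H8` is not 3-colorable, so the balanced 3-partite graph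
doubled in both colors omits `H8`, with density at least 4/3. As `T` is 3-colorable, this also rules
out a `T`-coloring. Upper bound: weight each pair by its number of colors. Total weight beyond 4/3
of the square of the order forces a 4-cycle of double edges with both diagonals colored
(`three_mul_sum_le_four_mul_card_sq`). Diagonals sharing a color give `T1`, otherwise `T2`.
Averaging over maps from an `m`-set turns one copy into a positive density of copies
(`le_card_isHom_T1_or_T2`). One of `T1`, `T2` is then dense, so a large blow-up of it appears
(`exists_embeddings_of_dense_relation`), and it contains `H8` because `H8` is colorable by both. -/

open Finset

/-! ### The weighted extremal bound -/

/-- If a symmetric weighting with values at most `2` and zero diagonal has no 4-cycle of weight-`2`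
pairs both of whose diagonals are positive, its total weight on `U × U` is at most `4/3 * |U|²`. -/
theorem three_mul_sum_le_four_mul_card_sq {V : Type*} [DecidableEq V] (w : V → V → ℕ)
    (symm : ∀ x y, w x y = w y x) (diag : ∀ x, w x x = 0) (le_two : ∀ x y, w x y ≤ 2)
    (free : ∀ a b c d, w a b = 2 → w b c = 2 → w c d = 2 → w d a = 2 → w a c ≠ 0 → w b d = 0)
    (U : Finset V) : 3 * ∑ x ∈ U, ∑ y ∈ U, w x y ≤ 4 * #U ^ 2 := by
  have sum_insert_insert : ∀ (s : Finset V) (a : V), a ∉ s →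
      ∑ x ∈ insert a s, ∑ y ∈ insert a s, w x y
        = ∑ x ∈ s, ∑ y ∈ s, w x y + 2 * ∑ x ∈ s, w x a := by
    intro s a ha
    simp only [sum_insert ha, sum_add_distrib, diag, fun y => symm a y]
    ring
  have ne : ∀ {x y}, w x y ≠ 0 → x ≠ y := by
    rintro x y h rfl
    exact h (diag x)
  induction U using Finset.strongInduction with
  | H U ih =>
    -- Deleting such a triple loses at most `2 * 4 * #s + 2 * 6`, and `3` times this is exactly `4 *
    -- (#s + 3) ^ 2 - 4 * #s ^ 2`.
    have triple : ∀ a ∈ U, ∀ b ∈ U, ∀ c ∈ U, w a b ≠ 0 → w a c ≠ 0 → w b c ≠ 0 →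
        (∀ v ∈ U, w v a + w v b + w v c ≤ 4) →
        3 * ∑ x ∈ U, ∑ y ∈ U, w x y ≤ 4 * #U ^ 2 := by
      intro a ha b hb c hc hab hac hbc hv
      have nab := ne hab
      have nac := ne hac
      have nbc := ne hbc
      set s := ((U.erase a).erase b).erase c with hs
      have hsc : c ∉ s := by simp [hs]
      have hsb : b ∉ insert c s := by simp [hs, nbc]
      have hsa : a ∉ insert b (insert c s) := by simp [hs, nab, nac]
      have hU : U = insert a (insert b (insert c s)) := by
        rw [hs, insert_erase (by simp [hc, nbc.symm, nac.symm]),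
          insert_erase (by simp [hb, nab.symm]), insert_erase ha]
      have hsub : s ⊂ U := ssubset_of_subset_of_ne
        (by rw [hU]; intro x hx; simp [hx]) (by rintro h; rw [h] at hsc; exact hsc hc)
      have hsum : ∑ x ∈ s, (w x a + w x b + w x c) ≤ #s * 4 :=
        sum_le_card_nsmul _ _ _ fun v hvs => hv v (hsub.1 hvs)
      have hcard : #U = #s + 3 := by
        rw [hU, card_insert_of_notMem hsa, card_insert_of_notMem hsb, card_insert_of_notMem hsc]
      have h := ih s hsub
      have h1 := le_two c b
      have h2 := le_two c a
      have h3 := le_two b a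
      rw [hcard, hU, sum_insert_insert _ _ hsa, sum_insert_insert _ _ hsb,
        sum_insert_insert _ _ hsc, sum_insert hsb, sum_insert hsc, sum_insert hsc]
      simp only [sum_add_distrib] at hsum
      nlinarith
    by_cases htri : ∃ a ∈ U, ∃ b ∈ U, ∃ c ∈ U, w a b = 2 ∧ w a c = 2 ∧ w b c = 2
    · obtain ⟨a, ha, b, hb, c, hc, hab, hac, hbc⟩ := htri
      refine triple a ha b hb c hc (by omega) (by omega) (by omega) fun v _ => ?_
      -- Weight at least 5 from `v` means two 2's and a nonzero third; the cycle through `v` and the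
      -- triangle that uses the two 2's is then forbidden.
      have h1 := free v a c b
      have h2 := free v a b c
      have h3 := free v b a c
      have := symm a b
      have := symm a c
      have := symm b c
      have := symm v a
      have := symm v b
      have := symm v c
      have := le_two v a
      have := le_two v b
      have := le_two v c
      grind
    by_cases hcherry : ∃ a ∈ U, ∃ b ∈ U, ∃ c ∈ U, w a b = 2 ∧ w a c = 2 ∧ w b c ≠ 0
    · obtain ⟨a, ha, b, hb, c, hc, hab, hac, hbc⟩ := hcherry
      refine triple a ha b hb c hc (by omega) (by omega) hbc fun v hv => ?_
      -- Weight at least 5 now gives either a double triangle on `v`, `a` and one of `b`, `c`, or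
      -- the forbidden cycle `a b v c`.
      have h1 := free a b v c
      have h2 : ¬ (w v a = 2 ∧ w v b = 2) := fun h =>
        htri ⟨v, hv, a, ha, b, hb, h.1, h.2, hab⟩
      have h3 : ¬ (w v a = 2 ∧ w v c = 2) := fun h =>
        htri ⟨v, hv, a, ha, c, hc, h.1, h.2, hac⟩
      have := symm a c
      have := symm v a
      have := symm v b
      have := le_two v a
      have := le_two v b
      have := le_two v c
      grind
    by_cases hedge : ∃ a ∈ U, ∃ b ∈ U, w a b = 2
    · obtain ⟨a, ha, b, hb, hab⟩ := hedge
      have nab : a ≠ b := ne (by omega)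
      set s := (U.erase a).erase b with hs
      have hsb : b ∉ s := by simp [hs]
      have hsa : a ∉ insert b s := by simp [hs, nab]
      have hU : U = insert a (insert b s) := by
        rw [hs, insert_erase (by simp [hb, nab.symm]), insert_erase ha]
      have hsub : s ⊂ U := ssubset_of_subset_of_ne
        (by rw [hU]; intro x hx; simp [hx]) (by rintro h; rw [h] at hsb; exact hsb hb)
      -- A vertex of weight at least 3 to the double edge `ab` would complete a cherry with nonzero
      -- base.
      have hsum : ∑ x ∈ s, (w x a + w x b) ≤ #s * 2 := by
        refine sum_le_card_nsmul _ _ _ fun v hvs => ?_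
        have hv := hsub.1 hvs
        have h1 : ¬ (w a b = 2 ∧ w a v = 2 ∧ w b v ≠ 0) := fun h =>
          hcherry ⟨a, ha, b, hb, v, hv, h⟩
        have h2 : ¬ (w b a = 2 ∧ w b v = 2 ∧ w a v ≠ 0) := fun h =>
          hcherry ⟨b, hb, a, ha, v, hv, h⟩
        have := symm a b
        have := symm v a
        have := symm v b
        have := le_two v a
        have := le_two v b
        grind
      have hcard : #U = #s + 2 := by
        rw [hU, card_insert_of_notMem hsa, card_insert_of_notMem hsb]
      have h := ih s hsub
      have h1 := le_two b a
      rw [hcard, hU, sum_insert_insert _ _ hsa, sum_insert_insert _ _ hsb, sum_insert hsb]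
      simp only [sum_add_distrib] at hsum
      nlinarith
    · have h : ∑ x ∈ U, ∑ y ∈ U, w x y ≤ #U * (#U * 1) := by
        refine sum_le_card_nsmul _ _ _ fun x hx => sum_le_card_nsmul _ _ _ fun y hy => ?_
        have := le_two x y
        have : w x y ≠ 2 := fun h => hedge ⟨x, hx, y, hy, h⟩
        omega
      nlinarith

/-! ### Averaging and complete multipartite subrelations -/

/-- Summing a function of the coordinates selected by an embedding over all maps into `V`. -/
theorem card_pow_mul_sum_comp_embedding {ι κ V : Type*} [Fintype ι] [Fintype κ] [Fintype V]
    [DecidableEq ι] [DecidableEq κ] (q : κ ↪ ι) (F : (κ → V) → ℝ) :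
    (Fintype.card V : ℝ) ^ Fintype.card κ * ∑ φ : ι → V, F (φ ∘ q)
      = (Fintype.card V : ℝ) ^ Fintype.card ι * ∑ ψ : κ → V, F ψ := by
  classical
  let e : κ ⊕ {i // i ∉ Set.range q} ≃ ι :=
    (Equiv.sumCongr (Equiv.ofInjective q q.injective) (Equiv.refl _)).trans
      (Equiv.sumCompl (· ∈ Set.range q))
  have he : ∀ x, e (Sum.inl x) = q x := fun x => rfl
  let E : (ι → V) ≃ (κ → V) × ({i // i ∉ Set.range q} → V) :=
    (Equiv.arrowCongr e.symm (Equiv.refl V)).trans (Equiv.sumArrowEquivProdArrow _ _ _)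
  have hE : ∀ φ, (E φ).1 = φ ∘ q := fun φ => rfl
  have hcard : Fintype.card ι = Fintype.card κ + Fintype.card {i // i ∉ Set.range q} := by
    rw [← Fintype.card_congr e, Fintype.card_sum]
  have hsum : ∑ φ : ι → V, F (φ ∘ q)
      = (Fintype.card V : ℝ) ^ Fintype.card {i // i ∉ Set.range q} * ∑ ψ : κ → V, F ψ := by
    rw [Fintype.sum_equiv E _ (fun p => F p.1) (fun φ => by rw [hE]), Fintype.sum_prod_type]
    simp [mul_sum]
  rw [hsum, hcard, pow_add]
  ring

theorem tendsto_descFactorial_div_pow (m : ℕ) :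
    Tendsto (fun n : ℕ => (n.descFactorial m : ℝ) / (n : ℝ) ^ m) atTop (𝓝 1) := by
  refine (Asymptotics.isEquivalent_iff_tendsto_one ?_).1 (isEquivalent_descFactorial m)
  filter_upwards [eventually_ne_atTop 0] with n hn
  positivity

open Classical in
/-- A dense `k`-ary relation on a large finite set contains a complete `k`-partite subrelation. -/
theorem exists_embeddings_of_dense_relation (m k : ℕ) :
    ∀ c : ℝ, 0 < c → ∃ N : ℕ, ∀ (V : Type) [Fintype V], N ≤ Fintype.card V →
      ∀ P : (Fin k → V) → Prop,
        c * (Fintype.card V : ℝ) ^ k ≤ #{ψ : Fin k → V | P ψ} →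
        ∃ g : Fin k → Fin (m + 1) ↪ V, ∀ j : Fin k → Fin (m + 1), P fun i => g i (j i) := by
  induction k with
  | zero =>
    intro c hc
    refine ⟨0, fun V _ _ P hP => ⟨Fin.elim0, fun j => ?_⟩⟩
    have hpos : 0 < #{ψ : Fin 0 → V | P ψ} := by
      have : (0 : ℝ) < #{ψ : Fin 0 → V | P ψ} := lt_of_lt_of_le (by simpa using hc) hP
      exact_mod_cast this
    obtain ⟨ψ, hψ⟩ := card_pos.1 hpos
    rw [Subsingleton.elim (fun i => _) ψ]
    exact (mem_filter.1 hψ).2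
  | succ k ih =>
    intro c hc
    have hc' : 0 < c ^ (m + 1) / 2 := by positivity
    obtain ⟨N₁, hN₁⟩ := ih _ hc'
    obtain ⟨N₂, hN₂⟩ := eventually_atTop.1
      ((tendsto_descFactorial_div_pow (m + 1)).eventually_const_lt
        (show 1 - c ^ (m + 1) / 2 < 1 by linarith))
    refine ⟨max (max N₁ N₂) 1, fun V _ hV P hP => ?_⟩
    have hn1 : N₁ ≤ Fintype.card V := le_trans (by simp) hV
    have hdesc := hN₂ (Fintype.card V) (le_trans (by simp) hV)
    have hn : (0 : ℝ) < Fintype.card V := by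
      exact_mod_cast lt_of_lt_of_le one_pos (le_trans (le_max_right _ _) hV)
    set n : ℝ := (Fintype.card V : ℝ) with hndef
    obtain ⟨Q, hQ⟩ : ∃ Q : (Fin (m + 1) → V) → (Fin k → V) → Prop,
      ∀ h ψ, Q h ψ ↔ ∀ l, P (Fin.cons (h l) ψ) := ⟨_, fun _ _ => Iff.rfl⟩
    -- Fix the first part `h` so that many `ψ` extend all its points, then apply induction to those
    -- `ψ`.
    suffices H : ∃ h : Fin (m + 1) ↪ V, c ^ (m + 1) / 2 * n ^ k ≤ #{ψ | Q h ψ} by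
      obtain ⟨h, hh⟩ := H
      obtain ⟨g, hg⟩ := hN₁ V hn1 _ hh
      refine ⟨Fin.cons h g, fun j => ?_⟩
      have key : (fun i => (Fin.cons h g : Fin (k + 1) → Fin (m + 1) ↪ V) i (j i))
          = Fin.cons (h (j 0)) fun i => g i (j i.succ) := by
        funext i
        refine Fin.cases ?_ (fun i => ?_) i
        · rfl
        · rfl
      rw [key]
      exact (hQ _ _).1 (hg fun i => j i.succ) (j 0)
    by_contra! hcon
    let d : (Fin k → V) → ℕ := fun ψ => #{x | P (Fin.cons x ψ)}
    have hd : ∑ ψ, d ψ = #{ψ : Fin (k + 1) → V | P ψ} := by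
      simp only [d, card_filter]
      rw [sum_comm, ← Fintype.sum_prod_type']
      exact Fintype.sum_equiv (Fin.consEquiv fun _ => V) _ _ fun p => rfl
    have hdpow : ∀ ψ, d ψ ^ (m + 1) = #{h | Q h ψ} := by
      intro ψ
      rw [← Fintype.card_piFinset_const]
      congr 1
      ext h
      simp [hQ]
    have hcount : ∑ ψ, d ψ ^ (m + 1) = ∑ h, #{ψ | Q h ψ} := by
      simp only [hdpow, card_filter]
      exact sum_comm
    -- Power mean inequality for the degrees `d ψ`. Non-injective `h` number less than `c ^ (m + 1)
    -- / 2 * n ^ (m + 1)`, so an injective `h` must carry the rest.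
    have hlow : c ^ (m + 1) * n ^ (m + 1) * n ^ k ≤ ∑ h, (#{ψ | Q h ψ} : ℝ) := by
      have hJ := pow_sum_div_card_le_sum_pow (s := (univ : Finset (Fin k → V)))
        (f := fun ψ => (d ψ : ℝ)) (fun _ _ => by positivity) m
      have hd' : ∑ ψ, (d ψ : ℝ) = #{ψ : Fin (k + 1) → V | P ψ} := by exact_mod_cast hd
      have hcount' : ∑ ψ, (d ψ : ℝ) ^ (m + 1) = ∑ h, (#{ψ | Q h ψ} : ℝ) := by
        exact_mod_cast hcount
      rw [hd', hcount'] at hJ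
      refine le_trans ?_ hJ
      rw [card_univ, Fintype.card_fun, Fintype.card_fin, Nat.cast_pow, ← hndef,
        le_div_iff₀ (by positivity)]
      calc c ^ (m + 1) * n ^ (m + 1) * n ^ k * (n ^ k) ^ m = (c * n ^ (k + 1)) ^ (m + 1) := by ring
        _ ≤ _ := pow_le_pow_left₀ (by positivity) hP _
    have hinj : (#{h : Fin (m + 1) → V | Function.Injective h} : ℝ)
        = ((Fintype.card V).descFactorial (m + 1) : ℝ) := by
      rw [← Fintype.card_subtype, Fintype.card_congr (Equiv.subtypeInjectiveEquivEmbedding _ _),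
        Fintype.card_embedding_eq, Fintype.card_fin]
    have hsplit := card_filter_add_card_filter_not (s := (univ : Finset (Fin (m + 1) → V)))
      Function.Injective
    have hsplit' : (#{h : Fin (m + 1) → V | Function.Injective h} : ℝ)
        + #{h : Fin (m + 1) → V | ¬ Function.Injective h} = n ^ (m + 1) := by
      rw [card_univ, Fintype.card_fun, Fintype.card_fin] at hsplit
      rw [hndef]
      exact_mod_cast hsplit
    have hup : ∑ h, (#{ψ | Q h ψ} : ℝ)
        ≤ #{h : Fin (m + 1) → V | Function.Injective h} * (c ^ (m + 1) / 2 * n ^ k)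
          + #{h : Fin (m + 1) → V | ¬ Function.Injective h} * n ^ k := by
      rw [← sum_filter_add_sum_filter_not univ Function.Injective]
      simp only [← nsmul_eq_mul]
      refine add_le_add (sum_le_card_nsmul _ _ _ fun h hh => ?_)
        (sum_le_card_nsmul _ _ _ fun h hh => ?_)
      · exact (hcon ⟨h, (mem_filter.1 hh).2⟩).le
      · have := card_le_univ ({ψ | Q h ψ} : Finset (Fin k → V))
        rw [Fintype.card_fun, Fintype.card_fin] at this
        rw [hndef]
        exact_mod_cast this
    rw [lt_div_iff₀ (by positivity), ← hinj] at hdesc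
    have hle : (#{h : Fin (m + 1) → V | Function.Injective h} : ℝ) ≤ n ^ (m + 1) := by
      have : (0 : ℝ) ≤ #{h : Fin (m + 1) → V | ¬ Function.Injective h} := by positivity
      linarith
    have hnk : 0 < n ^ k := by positivity
    have h3 := hlow.trans hup
    have h4 : c ^ (m + 1) * n ^ (m + 1)
        ≤ #{h : Fin (m + 1) → V | Function.Injective h} * (c ^ (m + 1) / 2)
          + #{h : Fin (m + 1) → V | ¬ Function.Injective h} := by
      refine le_of_mul_le_mul_right ?_ hnk
      linarith
    have h5 := mul_le_mul_of_nonneg_right hle hc'.le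
    linarith

/-! ### Multiplicities and the small graphs -/

namespace TwoColoredGraph

open Classical in
/-- The number of colors of the pair `xy` in `G`. -/
noncomputable def mult {V : Type*} (G : TwoColoredGraph V) (x y : V) : ℕ :=
  (if G.red.Adj x y then 1 else 0) + (if G.blue.Adj x y then 1 else 0)

section mult

variable {V : Type*} (G : TwoColoredGraph V) (x y : V)

theorem mult_comm : G.mult x y = G.mult y x := by
  unfold mult
  rw [G.red.adj_comm x y, G.blue.adj_comm x y]

theorem mult_self : G.mult x x = 0 := by simp [mult]

theorem mult_le_two : G.mult x y ≤ 2 := by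
  unfold mult
  split_ifs <;> norm_num

theorem mult_eq_two_iff : G.mult x y = 2 ↔ G.red.Adj x y ∧ G.blue.Adj x y := by
  unfold mult
  split_ifs <;> simp_all

theorem mult_ne_zero_iff : G.mult x y ≠ 0 ↔ G.red.Adj x y ∨ G.blue.Adj x y := by
  unfold mult
  split_ifs <;> simp_all

end mult

theorem sum_mult {n : ℕ} (G : TwoColoredGraph (Fin n)) :
    ∑ x, ∑ y, G.mult x y = 2 * (G.red.edgeSet.ncard + G.blue.edgeSet.ncard) := by
  classical
  have h : ∀ S : SimpleGraph (Fin n),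
      ∑ x, ∑ y, (if S.Adj x y then 1 else 0) = 2 * S.edgeSet.ncard := by
    intro S
    rw [← SimpleGraph.coe_edgeFinset, Set.ncard_coe_finset, SimpleGraph.two_mul_card_edgeFinset,
      card_filter, Fintype.sum_prod_type]
  simp only [mult, sum_add_distrib, mul_add, ← h]

instance {n : ℕ} (r b : List (ℕ × ℕ)) : DecidableRel (ofEdges n r b).red.Adj := fun i j =>
  inferInstanceAs (Decidable (i ≠ j ∧ (_ ∈ r ∨ _ ∈ r)))

instance {n : ℕ} (r b : List (ℕ × ℕ)) : DecidableRel (ofEdges n r b).blue.Adj := fun i j =>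
  inferInstanceAs (Decidable (i ≠ j ∧ (_ ∈ b ∨ _ ∈ b)))

instance : DecidableRel T.red.Adj := inferInstanceAs (DecidableRel (ofEdges _ _ _).red.Adj)
instance : DecidableRel T.blue.Adj := inferInstanceAs (DecidableRel (ofEdges _ _ _).blue.Adj)
instance : DecidableRel T1.red.Adj := inferInstanceAs (DecidableRel (ofEdges _ _ _).red.Adj)
instance : DecidableRel T1.blue.Adj := inferInstanceAs (DecidableRel (ofEdges _ _ _).blue.Adj)
instance : DecidableRel T2.red.Adj := inferInstanceAs (DecidableRel (ofEdges _ _ _).red.Adj)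
instance : DecidableRel T2.blue.Adj := inferInstanceAs (DecidableRel (ofEdges _ _ _).blue.Adj)
instance : DecidableRel H8.red.Adj := inferInstanceAs (DecidableRel (ofEdges _ _ _).red.Adj)
instance : DecidableRel H8.blue.Adj := inferInstanceAs (DecidableRel (ofEdges _ _ _).blue.Adj)

/-- Completeness makes homomorphisms from `T1` into loopless graphs injective, and keeps distinct
parts of a blow-up apart. -/
theorem T1_adj_of_ne : ∀ i j : Fin 4, i ≠ j → T1.red.Adj i j ∨ T1.blue.Adj i j := by decide

theorem T2_adj_of_ne : ∀ i j : Fin 4, i ≠ j → T2.red.Adj i j ∨ T2.blue.Adj i j := by decide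

theorem H8_colorableBy_T1 : H8.ColorableBy T1 :=
  ⟨![0, 1, 2, 3, 3, 2, 0, 1], by decide, by decide⟩

theorem H8_colorableBy_T2 : H8.ColorableBy T2 :=
  ⟨![1, 3, 3, 1, 0, 2, 2, 0], by decide, by decide⟩

/-- Homomorphisms into 2-colored graphs from one given by edge lists are checked on the lists. -/
theorem isHom_ofEdges {n : ℕ} {r b : List (ℕ × ℕ)} {V : Type*} {G : TwoColoredGraph V}
    {f : Fin n → V}
    (hr : ∀ i j : Fin n, ((i : ℕ) + 1, (j : ℕ) + 1) ∈ r → G.red.Adj (f i) (f j))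
    (hb : ∀ i j : Fin n, ((i : ℕ) + 1, (j : ℕ) + 1) ∈ b → G.blue.Adj (f i) (f j)) :
    (ofEdges n r b).IsHom G f :=
  ⟨fun i j h => h.2.elim (hr i j) fun h => (hr j i h).symm,
    fun i j h => h.2.elim (hb i j) fun h => (hb j i h).symm⟩

/-- A 4-cycle of doubly colored edges with both diagonals colored contains `T1` or `T2`. -/
theorem isHom_T1_or_T2_of_mult {V : Type*} (G : TwoColoredGraph V) {a b c d : V}
    (hab : G.mult a b = 2) (hbc : G.mult b c = 2) (hcd : G.mult c d = 2) (hda : G.mult d a = 2)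
    (hac : G.mult a c ≠ 0) (hbd : G.mult b d ≠ 0) :
    ∃ ψ : Fin 4 → V, T1.IsHom G ψ ∨ T2.IsHom G ψ := by
  rw [mult_eq_two_iff] at hab hbc hcd hda
  rw [mult_ne_zero_iff] at hac hbd
  have hba := And.intro hab.1.symm hab.2.symm
  have hcb := And.intro hbc.1.symm hbc.2.symm
  have hdc := And.intro hcd.1.symm hcd.2.symm
  have had := And.intro hda.1.symm hda.2.symm
  -- The doubled pairs of `T2` form the cycle 1234, with 13 blue and 24 red, so the mixed cases only
  -- need a rotation. In `T1` the cycle is 1234 for red diagonals and 1243 for blue ones.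
  rcases hac with hac | hac <;> rcases hbd with hbd | hbd
  · refine ⟨![a, b, c, d], Or.inl (isHom_ofEdges ?_ ?_)⟩ <;>
      simp [Fin.forall_fin_succ, *]
  · refine ⟨![b, c, d, a], Or.inr (isHom_ofEdges ?_ ?_)⟩ <;>
      simp [Fin.forall_fin_succ, hac.symm, *]
  · refine ⟨![a, b, c, d], Or.inr (isHom_ofEdges ?_ ?_)⟩ <;>
      simp [Fin.forall_fin_succ, *]
  · refine ⟨![a, b, d, c], Or.inl (isHom_ofEdges ?_ ?_)⟩ <;>
      simp [Fin.forall_fin_succ, *]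

-- Serves twice: against copies of `H8` in 3-partite graphs and against `T`-colorings.
set_option synthInstance.maxSize 1000 in
set_option synthInstance.maxHeartbeats 200000 in
theorem not_three_colorable_H8 (f : Fin 8 → Fin 3) :
    ¬ ∀ i j, H8.red.Adj i j ∨ H8.blue.Adj i j → f i ≠ f j := by
  -- Each edge constraint follows its second endpoint at once, so that the exhaustive check prunes
  -- early.
  have key : ∀ a b : Fin 3, a ≠ b → ∀ c, a ≠ c → ∀ d, b ≠ d → c ≠ d →
      ∀ e, a ≠ e → b ≠ e → c ≠ e → ∀ g, a ≠ g → b ≠ g → d ≠ g → e ≠ g →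
      ∀ h, b ≠ h → c ≠ h → d ≠ h → e ≠ h →
      ∀ k, a ≠ k → c ≠ k → d ≠ k → g ≠ k → h ≠ k → False := by decide
  intro hf
  refine key (f 0) (f 1) ?_ (f 2) ?_ (f 3) ?_ ?_ (f 4) ?_ ?_ ?_ (f 5) ?_ ?_ ?_ ?_ (f 6) ?_ ?_ ?_ ?_
    (f 7) ?_ ?_ ?_ ?_ ?_ <;> exact hf _ _ (by decide)

theorem H8_not_colorableBy_T : ¬ H8.ColorableBy T := by
  -- Vertices 1 and 4 are nonadjacent in `T` and may share a color.
  have key : ∀ i j : Fin 4, T.red.Adj i j ∨ T.blue.Adj i j →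
      (![0, 1, 2, 0] : Fin 4 → Fin 3) i ≠ ![0, 1, 2, 0] j := by decide
  rintro ⟨f, hr, hb⟩
  exact not_three_colorable_H8 (fun i => ![0, 1, 2, 0] (f i)) fun i j hij =>
    key _ _ (hij.imp (hr i j) (hb i j))

/-! ### Supersaturation -/

/-- `ψ` is a homomorphism to `G` from `T1` or from `T2`. -/
def IsHomT1OrT2 {V : Type*} (G : TwoColoredGraph V) (ψ : Fin 4 → V) : Prop :=
  T1.IsHom G ψ ∨ T2.IsHom G ψ

open Classical in
/-- In a map of a finite set into a graph without `T1` and `T2` in its image, the pulled-back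
multiplicities obey the extremal bound; otherwise the trivial bound is charged to the copies. -/
theorem three_mul_sum_mult_comp_le {m : ℕ} {V : Type*} (G : TwoColoredGraph V) (φ : Fin m → V) :
    3 * ∑ i, ∑ j, G.mult (φ i) (φ j) ≤ 4 * m ^ 2
      + 2 * m ^ 2 * #{q : Fin 4 ↪ Fin m | G.IsHomT1OrT2 (φ ∘ q)} := by
  by_cases hq : ∃ q : Fin 4 ↪ Fin m, G.IsHomT1OrT2 (φ ∘ q)
  · obtain ⟨q, hq⟩ := hq
    have hpos : 1 ≤ #{q : Fin 4 ↪ Fin m | G.IsHomT1OrT2 (φ ∘ q)} :=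
      card_pos.2 ⟨q, by simpa using hq⟩
    -- The trivial bound `6 * m ^ 2` is `4 * m ^ 2` plus the charge for one copy.
    have hsum : ∑ i, ∑ j, G.mult (φ i) (φ j)
        ≤ #(univ : Finset (Fin m)) * (#(univ : Finset (Fin m)) * 2) :=
      sum_le_card_nsmul _ _ _ fun i _ => sum_le_card_nsmul _ _ _ fun j _ => mult_le_two _ _ _
    rw [card_univ, Fintype.card_fin] at hsum
    nlinarith [Nat.mul_le_mul_left (2 * m ^ 2) hpos]
  · have h := three_mul_sum_le_four_mul_card_sq (fun i j => G.mult (φ i) (φ j))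
      (fun _ _ => mult_comm _ _ _) (fun _ => mult_self _ _) (fun _ _ => mult_le_two _ _ _) ?_ univ
    · rw [card_univ, Fintype.card_fin] at h
      exact h.trans (Nat.le_add_right _ _)
    · intro a b c d hab hbc hcd hda hac
      by_contra hbd
      obtain ⟨ψ, hhom⟩ := isHom_T1_or_T2_of_mult (V := Fin m)
        ⟨G.red.comap φ, G.blue.comap φ⟩ hab hbc hcd hda hac hbd
      refine hq ⟨⟨ψ, fun i j hij => by_contra fun hne => ?_⟩, hhom⟩
      rcases hhom with h | h
      · rcases T1_adj_of_ne i j hne with h' | h'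
        · exact (h.1 _ _ h').ne hij
        · exact (h.2 _ _ h').ne hij
      · rcases T2_adj_of_ne i j hne with h' | h'
        · exact (h.1 _ _ h').ne hij
        · exact (h.2 _ _ h').ne hij

open Classical in
/-- Supersaturation: a graph with edge density above `4/3` has a positive density of homomorphic
images of `T1` and `T2`. -/
theorem le_card_isHom_T1_or_T2 {ε : ℝ} (hε : 0 < ε) {m n : ℕ} (hm : 6 ≤ m) (hmε : 8 ≤ ε * m)
    (hmn : m ≤ n) (G : TwoColoredGraph (Fin n)) (hG : 4 / 3 + ε < G.edgeDensity) :
    ε / (2 * m ^ 4) * n ^ 4 ≤ #{ψ : Fin 4 → Fin n | G.IsHomT1OrT2 ψ} := by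
  set N : ℝ := ((#{ψ | G.IsHomT1OrT2 ψ} : ℕ) : ℝ) with hN
  have hn0 : (0 : ℝ) < n := by exact_mod_cast (by omega : 0 < n)
  have hm0 : (0 : ℝ) < m := by exact_mod_cast (by omega : 0 < m)
  have hm6 : (6 : ℝ) ≤ m := by exact_mod_cast hm
  have hmn' : (m : ℝ) ≤ n := by exact_mod_cast hmn
  set W : ℝ := ∑ x, ∑ y, (G.mult x y : ℝ) with hW
  have hWlow : (4 / 3 + ε) * (n * (n - 1)) ≤ W := by
    have h : W = 2 * (G.red.edgeSet.ncard + G.blue.edgeSet.ncard) := by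
      rw [hW]
      exact_mod_cast G.sum_mult
    rw [edgeDensity, Nat.cast_choose_two, lt_div_iff₀ (by nlinarith)] at hG
    linarith
  have hpair : ∀ i j : Fin m, i ≠ j →
      (n : ℝ) ^ 2 * ∑ φ : Fin m → Fin n, (G.mult (φ i) (φ j) : ℝ) = n ^ m * W := by
    intro i j hij
    have h := card_pow_mul_sum_comp_embedding (V := Fin n)
      (⟨![i, j], by
        intro a b
        fin_cases a <;> fin_cases b <;> simp [hij, hij.symm]⟩ : Fin 2 ↪ Fin m)
      (fun ψ => (G.mult (ψ 0) (ψ 1) : ℝ))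
    simp only [Fintype.card_fin] at h
    refine h.trans ?_
    rw [hW, ← Fintype.sum_prod_type']
    congr 1
    exact Fintype.sum_equiv (finTwoArrowEquiv _) _ _ fun ψ => rfl
  have hpairs : (n : ℝ) ^ 2 * ∑ φ : Fin m → Fin n, ∑ i, ∑ j, (G.mult (φ i) (φ j) : ℝ)
      = m * (m - 1) * (n ^ m * W) := by
    have h : ∀ i : Fin m, ∑ j, (n : ℝ) ^ 2 * ∑ φ : Fin m → Fin n, (G.mult (φ i) (φ j) : ℝ)
        = (m - 1) * (n ^ m * W) := by
      intro i
      rw [← add_sum_erase univ _ (mem_univ i),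
        sum_congr rfl fun j hj => hpair i j (ne_of_mem_erase hj).symm]
      simp [mult_self, card_erase_of_mem, Nat.cast_sub (by omega : 1 ≤ m)]
    rw [sum_comm, mul_sum]
    simp only [sum_comm (s := (univ : Finset (Fin m → Fin n))), mul_sum] at h ⊢
    rw [sum_congr rfl fun i _ => h i]
    simp [mul_assoc]
  have hquad : ∀ q : Fin 4 ↪ Fin m,
      (n : ℝ) ^ 4 * ∑ φ : Fin m → Fin n, (if G.IsHomT1OrT2 (φ ∘ q) then 1 else 0 : ℝ)
        = n ^ m * N := by
    intro q
    have h := card_pow_mul_sum_comp_embedding (V := Fin n) q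
      (fun ψ => if G.IsHomT1OrT2 ψ then 1 else 0 : _ → ℝ)
    simpa [hN] using h
  have hquads :
      (n : ℝ) ^ 4 * ∑ φ : Fin m → Fin n, (#{q : Fin 4 ↪ Fin m | G.IsHomT1OrT2 (φ ∘ q)} : ℝ)
      ≤ m ^ 4 * (n ^ m * N) := by
    have hcard : (Fintype.card (Fin 4 ↪ Fin m) : ℝ) ≤ m ^ 4 := by
      rw [Fintype.card_embedding_eq, Fintype.card_fin, Fintype.card_fin]
      exact_mod_cast Nat.descFactorial_le_pow m 4
    have h : ∀ φ : Fin m → Fin n, (#{q : Fin 4 ↪ Fin m | G.IsHomT1OrT2 (φ ∘ q)} : ℝ)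
        = ∑ q : Fin 4 ↪ Fin m, (if G.IsHomT1OrT2 (φ ∘ q) then 1 else 0 : ℝ) := by
      intro φ
      rw [card_filter]
      push_cast
      rfl
    rw [sum_congr rfl fun φ _ => h φ, sum_comm, mul_sum, sum_congr rfl fun q _ => hquad q,
      sum_const, card_univ, nsmul_eq_mul]
    exact mul_le_mul_of_nonneg_right hcard (by positivity)
  have hφ : 3 * ∑ φ : Fin m → Fin n, ∑ i, ∑ j, (G.mult (φ i) (φ j) : ℝ)
      ≤ 4 * m ^ 2 * n ^ m
        + 2 * m ^ 2 * ∑ φ : Fin m → Fin n, (#{q : Fin 4 ↪ Fin m | G.IsHomT1OrT2 (φ ∘ q)} : ℝ) := by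
    have h : ∀ φ : Fin m → Fin n, (3 : ℝ) * ∑ i, ∑ j, (G.mult (φ i) (φ j) : ℝ)
        ≤ 4 * m ^ 2 + 2 * m ^ 2 * (#{q : Fin 4 ↪ Fin m | G.IsHomT1OrT2 (φ ∘ q)} : ℝ) := fun φ => by
      exact_mod_cast three_mul_sum_mult_comp_le G φ
    have h' := sum_le_sum fun φ (_ : φ ∈ (univ : Finset (Fin m → Fin n))) => h φ
    rw [sum_add_distrib, sum_const, ← mul_sum, ← mul_sum, card_univ, Fintype.card_fun,
      Fintype.card_fin, Fintype.card_fin, nsmul_eq_mul] at h'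
    push_cast at h'
    linarith
  have hpow : (0 : ℝ) < n ^ m := by positivity
  have hmain : 3 * (m * (m - 1) * W) * n ^ 2 ≤ 4 * m ^ 2 * n ^ 4 + 2 * m ^ 6 * N := by
    refine le_of_mul_le_mul_left ?_ hpow
    have h1 := mul_le_mul_of_nonneg_left hφ (by positivity : (0 : ℝ) ≤ n ^ 4)
    have h2 := mul_le_mul_of_nonneg_left hquads (by positivity : (0 : ℝ) ≤ 2 * m ^ 2)
    have h3 := congrArg (3 * (n : ℝ) ^ 2 * ·) hpairs
    beta_reduce at h3
    nlinarith
  -- Two factors `(m - 1) / m` are lost: one to the diagonal `i = j`, one to `n - 1` against `n`.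
  -- Since `m ≥ 6` and `ε * m ≥ 8`, they cost at most `2 * ε` of the surplus `3 * ε`.
  have hratio : (n : ℝ) * (m - 1) ≤ m * (n - 1) := by linarith
  have hpoly : (4 + ε) * (m : ℝ) ^ 2 ≤ (4 + 3 * ε) * (m - 1) ^ 2 := by
    nlinarith
  have hW2 : (4 + ε) * (m : ℝ) ^ 2 * n ^ 2 ≤ 3 * (m * (m - 1) * W) := by
    have h1 : (4 + 3 * ε) * (n * (n - 1)) ≤ 3 * W := by linarith
    have h2 := mul_le_mul_of_nonneg_left h1 (mul_nonneg hm0.le (by linarith : (0:ℝ) ≤ m - 1))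
    have h3 := mul_le_mul_of_nonneg_left hratio
      (mul_nonneg (mul_nonneg (by positivity : (0:ℝ) ≤ 4 + 3 * ε) hn0.le)
        (by linarith : (0:ℝ) ≤ m - 1))
    have h4 := mul_le_mul_of_nonneg_right hpoly (by positivity : (0:ℝ) ≤ (n:ℝ) ^ 2)
    nlinarith
  have hfin : ε * m ^ 2 * n ^ 4 ≤ 2 * m ^ 6 * N := by
    have := mul_le_mul_of_nonneg_right hW2 (by positivity : (0:ℝ) ≤ (n:ℝ) ^ 2)
    nlinarith
  rw [div_mul_eq_mul_div, div_le_iff₀ (by positivity)]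
  refine le_of_mul_le_mul_left ?_ (by positivity : (0:ℝ) < (m:ℝ) ^ 2)
  linarith

/-! ### Blow-ups and the upper bound -/

/-- If `H` is `F`-colorable, `F` has all pairs colored and `F` has a positive density of
homomorphisms to a large graph `G`, then `G` contains `H`. -/
theorem exists_contains_of_card_isHom {k m : ℕ} (F : TwoColoredGraph (Fin k))
    (H : TwoColoredGraph (Fin (m + 1)))
    (hF : ∀ i j, i ≠ j → F.red.Adj i j ∨ F.blue.Adj i j) (hH : H.ColorableBy F)
    {c : ℝ} (hc : 0 < c) :
    ∃ N : ℕ, ∀ n, N ≤ n → ∀ G : TwoColoredGraph (Fin n),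
      c * (n : ℝ) ^ k ≤ {ψ : Fin k → Fin n | F.IsHom G ψ}.ncard → G.Contains H := by
  classical
  obtain ⟨f, hf⟩ := hH
  obtain ⟨N, hN⟩ := exists_embeddings_of_dense_relation m k c hc
  refine ⟨N, fun n hn G hG => ?_⟩
  obtain ⟨g, hg⟩ := hN (Fin n) (by simpa using hn) (fun ψ => F.IsHom G ψ) (by
    rw [← Set.ncard_coe_finset, coe_filter_univ, Fintype.card_fin]
    exact hG)
  -- Each vertex `v` goes to the point of index `v` in part `f v`. The ranges of the `g i` may
  -- overlap, so injectivity across parts comes from `hF`.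
  have hedge : ∀ u v : Fin (m + 1), f u ≠ f v →
      ∃ ψ : Fin k → Fin n, F.IsHom G ψ ∧ ψ (f u) = g (f u) u ∧ ψ (f v) = g (f v) v := fun u v huv =>
    ⟨_, hg (Function.update (fun _ => u) (f v) v), by simp [huv], by simp⟩
  refine ⟨fun v => g (f v) v, fun u v huv => ?_, fun u v huv => ?_, fun u v huv => ?_⟩
  · by_cases h : f u = f v
    · beta_reduce at huv
      rw [h] at huv
      exact (g (f v)).injective huv
    · obtain ⟨ψ, hψ, hu, hv⟩ := hedge u v h
      exfalso
      rcases hF _ _ h with h' | h'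
      · exact (hψ.1 _ _ h').ne (by rw [hu, hv]; exact huv)
      · exact (hψ.2 _ _ h').ne (by rw [hu, hv]; exact huv)
  · obtain ⟨ψ, hψ, hu, hv⟩ := hedge u v (hf.1 u v huv).ne
    have := hψ.1 _ _ (hf.1 u v huv)
    rwa [hu, hv] at this
  · obtain ⟨ψ, hψ, hu, hv⟩ := hedge u v (hf.2 u v huv).ne
    have := hψ.2 _ _ (hf.2 u v huv)
    rwa [hu, hv] at this

theorem eventually_contains_H8 {ε : ℝ} (hε : 0 < ε) :
    ∀ᶠ n : ℕ in atTop, ∀ G : TwoColoredGraph (Fin n), 4 / 3 + ε < G.edgeDensity →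
      G.Contains H8 := by
  classical
  obtain ⟨m, hm⟩ := exists_nat_ge (max 6 (8 / ε))
  have hm6 : 6 ≤ m := by exact_mod_cast (le_max_left _ _).trans hm
  have hmε : 8 ≤ ε * m := (div_le_iff₀' hε).1 ((le_max_right _ _).trans hm)
  have hc : 0 < ε / (2 * m ^ 4) / 2 := by
    have : 0 < m := by omega
    positivity
  obtain ⟨N₁, h₁⟩ := exists_contains_of_card_isHom T1 H8 T1_adj_of_ne H8_colorableBy_T1 hc
  obtain ⟨N₂, h₂⟩ := exists_contains_of_card_isHom T2 H8 T2_adj_of_ne H8_colorableBy_T2 hc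
  filter_upwards [eventually_ge_atTop m, eventually_ge_atTop N₁, eventually_ge_atTop N₂]
    with n hmn hn₁ hn₂ G hG
  have h := le_card_isHom_T1_or_T2 hε hm6 hmε hmn G hG
  have hle : #{ψ : Fin 4 → Fin n | G.IsHomT1OrT2 ψ}
      ≤ {ψ : Fin 4 → Fin n | T1.IsHom G ψ}.ncard + {ψ : Fin 4 → Fin n | T2.IsHom G ψ}.ncard := by
    refine le_trans (le_of_eq ?_) (Set.ncard_union_le _ _)
    rw [← Set.ncard_coe_finset, coe_filter_univ]
    rfl
  have hle' : (#{ψ : Fin 4 → Fin n | G.IsHomT1OrT2 ψ} : ℝ)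
      ≤ {ψ : Fin 4 → Fin n | T1.IsHom G ψ}.ncard + {ψ : Fin 4 → Fin n | T2.IsHom G ψ}.ncard := by
    exact_mod_cast hle
  by_cases hT : ε / (2 * m ^ 4) / 2 * n ^ 4 ≤ {ψ : Fin 4 → Fin n | T1.IsHom G ψ}.ncard
  · exact h₁ n hn₁ G hT
  · refine h₂ n hn₂ G ?_
    linarith

/-! ### The lower bound and the limit -/

theorem edgeDensity_le_two {n : ℕ} (G : TwoColoredGraph (Fin n)) : G.edgeDensity ≤ 2 := by
  classical
  have h : ∀ S : SimpleGraph (Fin n), (S.edgeSet.ncard : ℝ) ≤ n.choose 2 := by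
    intro S
    rw [← SimpleGraph.coe_edgeFinset, Set.ncard_coe_finset]
    have := S.card_edgeFinset_le_card_choose_two
    rw [Fintype.card_fin] at this
    exact_mod_cast this
  refine div_le_of_le_mul₀ (by positivity) (by norm_num) ?_
  linarith [h G.red, h G.blue]

theorem edgeDensity_le_maxDensity {W : Type*} {H : TwoColoredGraph W} {n : ℕ}
    {G : TwoColoredGraph (Fin n)} (hG : ¬ G.Contains H) : G.edgeDensity ≤ H.maxDensity n :=
  le_csSup ⟨2, by rintro _ ⟨G, -, rfl⟩; exact G.edgeDensity_le_two⟩ ⟨G, hG, rfl⟩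

/-- The complete balanced 3-partite graph in both colors. -/
def doubleTuran (n : ℕ) : TwoColoredGraph (Fin n) :=
  ⟨SimpleGraph.turanGraph n 3, SimpleGraph.turanGraph n 3⟩

theorem not_contains_H8_doubleTuran (n : ℕ) : ¬ (doubleTuran n).Contains H8 := by
  rintro ⟨f, -, hr, hb⟩
  refine not_three_colorable_H8 (fun i => ⟨f i % 3, Nat.mod_lt _ (by norm_num)⟩) fun i j hij h => ?_
  have hadj : (SimpleGraph.turanGraph n 3).Adj (f i) (f j) := hij.elim (hr i j) (hb i j)
  exact hadj (Fin.mk.inj_iff.1 h)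

theorem four_thirds_le_edgeDensity_doubleTuran {n : ℕ} (hn : 2 ≤ n) :
    4 / 3 ≤ (doubleTuran n).edgeDensity := by
  have hedge : n * (n - 1) ≤ 3 * (SimpleGraph.turanGraph n 3).edgeSet.ncard := by
    rw [← SimpleGraph.coe_edgeFinset, Set.ncard_coe_finset, SimpleGraph.card_edgeFinset_turanGraph]
    -- The Turán graph then has `3 * q ^ 2 + 2 * q * r + r.choose 2` edges.
    obtain ⟨q, r, hr, rfl⟩ : ∃ q r, r < 3 ∧ n = 3 * q + r :=
      ⟨n / 3, n % 3, Nat.mod_lt _ (by norm_num), (Nat.div_add_mod n 3).symm⟩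
    have hsub : (3 * q + r) ^ 2 - r ^ 2 = 3 * (3 * q ^ 2 + 2 * q * r) :=
      Nat.sub_eq_of_eq_add (by ring)
    have hmod : (3 * q + r) % 3 = r := by omega
    rw [hmod, hsub, show 3 * (3 * q ^ 2 + 2 * q * r) * (3 - 1) / (2 * 3) = 3 * q ^ 2 + 2 * q * r by
      omega]
    obtain ⟨s, hs⟩ : ∃ s, 3 * q + r = s + 1 := ⟨3 * q + r - 1, by omega⟩
    rw [hs, Nat.add_sub_cancel]
    interval_cases r <;> simp <;> nlinarith
  have hedge' : (n : ℝ) * (n - 1) ≤ 3 * (SimpleGraph.turanGraph n 3).edgeSet.ncard := by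
    have : ((n * (n - 1) : ℕ) : ℝ) ≤ 3 * (SimpleGraph.turanGraph n 3).edgeSet.ncard := by
      exact_mod_cast hedge
    rwa [Nat.cast_mul, Nat.cast_sub (by omega), Nat.cast_one] at this
  have hn' : (2 : ℝ) ≤ n := by exact_mod_cast hn
  rw [edgeDensity, Nat.cast_choose_two, le_div_iff₀ (by nlinarith)]
  simp only [doubleTuran]
  linarith

theorem H8_hasTuranDensity : H8.HasTuranDensity (4 / 3) := by
  refine tendsto_order.2 ⟨fun a ha => ?_, fun a ha => ?_⟩
  · filter_upwards [eventually_ge_atTop 2] with n hn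
    exact ha.trans_le ((four_thirds_le_edgeDensity_doubleTuran hn).trans
      (edgeDensity_le_maxDensity (not_contains_H8_doubleTuran n)))
  · filter_upwards [eventually_contains_H8 (show 0 < (a - 4 / 3) / 2 by linarith)] with n hn
    refine lt_of_le_of_lt (csSup_le ⟨_, _, not_contains_H8_doubleTuran n, rfl⟩ ?_)
      (show 4 / 3 + (a - 4 / 3) / 2 < a by linarith)
    rintro _ ⟨G, hG, rfl⟩
    exact not_lt.1 fun h => hG (hn G h)

end TwoColoredGraph

theorem lemma3p7 :
    TwoColoredGraph.H8.HasTuranDensity (4 / 3) ∧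
      TwoColoredGraph.H8.ColorableBy TwoColoredGraph.T1 ∧
      TwoColoredGraph.H8.ColorableBy TwoColoredGraph.T2 ∧
      ¬ TwoColoredGraph.H8.ColorableBy TwoColoredGraph.T :=
  ⟨TwoColoredGraph.H8_hasTuranDensity, TwoColoredGraph.H8_colorableBy_T1,
    TwoColoredGraph.H8_colorableBy_T2, TwoColoredGraph.H8_not_colorableBy_T⟩
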